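/- Let $p\ge 0$ be an integer, let $\mathbb{D}$ be the open unit disc and let $\mathcal{B}(\mathbb{C}^p)$ be the algebra of linear operators on the Hilbert space $\mathbb{C}^p$. Let $H^2_{\mathbb{C}^p}(\mathbb{D})$ be the Hardy space of all holomorphic functions $f:\mathbb{D}\to\mathbb{C}^p$ with $$\|f\|^2=\sup_{0\le r<1}\frac1{2\pi}\int_0^{2\pi}\|f(re^{i\theta})\|^2\,d\theta<\infty ,$$ which is a Hilbert space in this norm, and let $T_z$ be the operator on it given by $(T_zf)(w)=wf(w)$. Let $\Theta\in H^\infty_{\mathcal{B}(\mathbb{C}^p)}(\mathbb{D})$ be an inner multiplier, that is, a bounded holomorphic function $\Theta:\mathbb{D}\to\mathcal{B}(\mathbb{C}^p)$ whose radial limit $\Theta(e^{i\theta})=\lim_{r\to1^-}\Theta(re^{i\theta})$ exists and is an isometry of $\mathbb{C}^p$ for almost every $\theta$. Put $$\mathcal{Q}_\Theta=H^2_{\mathbb{C}^p}(\mathbb{D})\ominus\Theta H^2_{\mathbb{C}^p}(\mathbb{D}),\qquad S_\Theta=P_{\mathcal{Q}_\Theta}T_z|_{\mathcal{Q}_\Theta},$$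 where $P_{\mathcal{Q}_\Theta}$ is the orthogonal projection onto $\mathcal{Q}_\Theta$, and let $T$ be a bounded linear operator on $\mathcal{Q}_\Theta$. Then $T$ is compact if and only if the sequence $\{S_\Theta^{*m}TS_\Theta^m\}_{m\ge1}$ converges in the operator norm to some bounded linear operator on $\mathcal{Q}_\Theta$. -/

import Mathlib

open Filter Topology

noncomputable section

namespace VectorHardy

/-- The integral mean `∫_𝕋 ‖f(r e^{iθ})‖² dθ` with respect to the normalized Lebesgue measure on the
unit circle `𝕋`. -/
def mean {E : Type*} [NormedAddCommGroup E] (f : ℂ → E) (r : ℝ) : ℝ :=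
  Real.circleAverage (fun z => ‖f z‖ ^ 2) 0 r

section PowerSeries

theorem circleMap_mem {r : ℝ} (hr : r ∈ Set.Ico (0 : ℝ) 1) (θ : ℝ) :
    circleMap 0 r θ ∈ Metric.ball (0 : ℂ) 1 := by
  simp [abs_of_nonneg hr.1, hr.2]

theorem continuous_comp_circleMap {E : Type*} [NormedAddCommGroup E] {f : ℂ → E}
    (hf : ContinuousOn f (Metric.ball (0 : ℂ) 1))
    {r : ℝ} (hr : r ∈ Set.Ico (0 : ℝ) 1) : Continuous (fun θ => f (circleMap 0 r θ)) :=
  hf.comp_continuous (continuous_circleMap 0 r) (circleMap_mem hr)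

variable {E : Type*} [NormedAddCommGroup E] [InnerProductSpace ℂ E]

theorem summable_of_series {a : ℕ → E} {f : ℂ → E}
    (h : ∀ z ∈ Metric.ball (0 : ℂ) 1, HasSum (fun n => z ^ n • a n) (f z))
    {r : ℝ} (hr : r ∈ Set.Ico (0 : ℝ) 1) : Summable (fun n => r ^ n * ‖a n‖) := by
  obtain ⟨ρ, hρ1, hρ2⟩ := exists_between hr.2
  have hρ0 : 0 < ρ := hr.1.trans_lt hρ1
  have hz : (ρ : ℂ) ∈ Metric.ball (0 : ℂ) 1 := by
    simp [abs_of_pos hρ0, hρ2]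
  have ht := (h _ hz).summable.tendsto_atTop_zero.norm
  obtain ⟨C, hC⟩ := ht.bddAbove_range
  have hC' : ∀ n, ρ ^ n * ‖a n‖ ≤ C := by
    intro n
    have := hC ⟨n, rfl⟩
    simpa [norm_smul, abs_of_pos hρ0] using this
  have hq : r / ρ < 1 := (div_lt_one hρ0).2 hρ1
  have hq0 : 0 ≤ r / ρ := div_nonneg hr.1 hρ0.le
  refine Summable.of_nonneg_of_le (fun n => mul_nonneg (pow_nonneg hr.1 n) (norm_nonneg _))
    (fun n => ?_) ((summable_geometric_of_lt_one hq0 hq).mul_left C)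
  have e : r ^ n * ‖a n‖ = (ρ ^ n * ‖a n‖) * (r / ρ) ^ n := by
    rw [div_pow]
    field_simp
  rw [e]
  exact mul_le_mul_of_nonneg_right (hC' n) (pow_nonneg hq0 n)

theorem integral_char (m n : ℕ) :
    ∫ θ in (0 : ℝ)..2 * Real.pi,
      (starRingEnd ℂ) (Complex.exp (θ * Complex.I)) ^ n * Complex.exp (θ * Complex.I) ^ m
      = if m = n then (2 * Real.pi : ℂ) else 0 := by
  have e : ∀ θ : ℝ, (starRingEnd ℂ) (Complex.exp (θ * Complex.I)) ^ n
      * Complex.exp (θ * Complex.I) ^ m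
      = Complex.exp ((((m : ℂ) - n) * Complex.I) * θ) := by
    intro θ
    rw [← Complex.exp_conj, ← Complex.exp_nat_mul, ← Complex.exp_nat_mul, ← Complex.exp_add]
    congr 1
    simp
    ring
  simp_rw [e]
  split_ifs with hmn
  · simp [hmn]
  · have hne : ((m : ℂ) - n) * Complex.I ≠ 0 := by
      refine mul_ne_zero (sub_ne_zero.2 ?_) Complex.I_ne_zero
      exact_mod_cast hmn
    rw [integral_exp_mul_complex hne]
    have h1 : Complex.exp (((m : ℂ) - n) * Complex.I * ((2 * Real.pi : ℝ) : ℂ)) = 1 := by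
      rw [Complex.exp_eq_one_iff]
      exact ⟨(m : ℤ) - n, by push_cast; ring⟩
    rw [h1]
    simp

/-- Parseval's identity on the circle of radius `r < 1`. -/
theorem hasSum_mean [CompleteSpace E] {a : ℕ → E} {f : ℂ → E}
    (hf : ContinuousOn f (Metric.ball (0 : ℂ) 1))
    (h : ∀ z ∈ Metric.ball (0 : ℂ) 1, HasSum (fun n => z ^ n • a n) (f z))
    {r : ℝ} (hr : r ∈ Set.Ico (0 : ℝ) 1) :
    HasSum (fun n => (r ^ n * ‖a n‖) ^ 2) (mean f r) := by
  have hs := summable_of_series h hr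
  have hc := continuous_comp_circleMap hf hr
  have hnorm : ∀ (θ : ℝ) (n : ℕ), ‖circleMap 0 r θ ^ n • a n‖ = r ^ n * ‖a n‖ := by
    intro θ n
    simp [norm_smul, abs_of_nonneg hr.1]
  have hsum : ∀ θ : ℝ, HasSum (fun n => circleMap 0 r θ ^ n • a n) (f (circleMap 0 r θ)) :=
    fun θ => h _ (circleMap_mem hr θ)
  have hbd : ∀ θ : ℝ, ‖f (circleMap 0 r θ)‖ ≤ ∑' n, r ^ n * ‖a n‖ := fun θ => by
    rw [← (hsum θ).tsum_eq]
    refine (norm_tsum_le_tsum_norm (by simpa only [hnorm] using hs)).trans ?_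
    simp only [hnorm, le_refl]
  have hcm : ∀ n : ℕ, Continuous (fun θ : ℝ => circleMap 0 r θ ^ n • a n) := fun n =>
    ((continuous_circleMap 0 r).pow n).smul continuous_const
  -- Fourier coefficients
  have hF : ∀ n : ℕ, ∫ θ in (0 : ℝ)..2 * Real.pi,
      inner ℂ (circleMap 0 r θ ^ n • a n) (f (circleMap 0 r θ))
      = (2 * Real.pi : ℂ) * ((r ^ n * ‖a n‖) ^ 2 : ℝ) := by
    intro n
    have h1 : HasSum (fun m : ℕ => ∫ θ in (0 : ℝ)..2 * Real.pi,
        inner ℂ (circleMap 0 r θ ^ n • a n) (circleMap 0 r θ ^ m • a m))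
        (∫ θ in (0 : ℝ)..2 * Real.pi,
          inner ℂ (circleMap 0 r θ ^ n • a n) (f (circleMap 0 r θ))) := by
      refine intervalIntegral.hasSum_integral_of_dominated_convergence
        (fun m _ => (r ^ n * ‖a n‖) * (r ^ m * ‖a m‖)) (fun m => ?_) (fun m => ?_) ?_ ?_ ?_
      · exact ((hcm n).inner (hcm m)).aestronglyMeasurable
      · refine Eventually.of_forall fun θ _ => ?_
        rw [← hnorm θ n, ← hnorm θ m]
        exact norm_inner_le_norm _ _
      · exact Eventually.of_forall fun θ _ => hs.mul_left _
      · exact intervalIntegrable_const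
      · exact Eventually.of_forall fun θ _ => (hsum θ).mapL (innerSL ℂ (circleMap 0 r θ ^ n • a n))
    have h2 : ∀ m : ℕ, ∫ θ in (0 : ℝ)..2 * Real.pi,
        inner ℂ (circleMap 0 r θ ^ n • a n) (circleMap 0 r θ ^ m • a m)
        = if m = n then (2 * Real.pi : ℂ) * ((r ^ n * ‖a n‖) ^ 2 : ℝ) else 0 := by
      intro m
      have e : ∀ θ : ℝ, inner ℂ (circleMap 0 r θ ^ n • a n) (circleMap 0 r θ ^ m • a m)
          = ((starRingEnd ℂ) (Complex.exp (θ * Complex.I)) ^ n * Complex.exp (θ * Complex.I) ^ m)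
            * ((r : ℂ) ^ n * (r : ℂ) ^ m * inner ℂ (a n) (a m)) := by
        intro θ
        rw [inner_smul_left, inner_smul_right]
        simp [circleMap, mul_pow]
        ring
      simp_rw [e]
      rw [intervalIntegral.integral_mul_const, integral_char]
      split_ifs with hmn
      · subst hmn
        rw [inner_self_eq_norm_sq_to_K]
        push_cast
        simp
        ring
      · simp
    rw [← h1.tsum_eq]
    simp_rw [h2]
    simp
  have h3 : HasSum (fun n : ℕ => ∫ θ in (0 : ℝ)..2 * Real.pi,
        inner ℂ (circleMap 0 r θ ^ n • a n) (f (circleMap 0 r θ)))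
        (∫ θ in (0 : ℝ)..2 * Real.pi,
          inner ℂ (f (circleMap 0 r θ)) (f (circleMap 0 r θ))) := by
    refine intervalIntegral.hasSum_integral_of_dominated_convergence
      (fun m _ => (r ^ m * ‖a m‖) * (∑' n, r ^ n * ‖a n‖)) (fun m => ?_) (fun m => ?_) ?_ ?_ ?_
    · exact ((hcm m).inner hc).aestronglyMeasurable
    · refine Eventually.of_forall fun θ _ => ?_
      rw [← hnorm θ m]
      exact (norm_inner_le_norm _ _).trans
        (mul_le_mul_of_nonneg_left (hbd θ) (norm_nonneg _))
    · exact Eventually.of_forall fun θ _ => hs.mul_right _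
    · exact intervalIntegrable_const
    · refine Eventually.of_forall fun θ _ => ?_
      have h6 := ((hsum θ).mapL (innerSL ℂ (f (circleMap 0 r θ)))).star
      have h7 : ∀ x y : E, star (innerSL ℂ x y) = inner ℂ y x := fun x y => inner_conj_symm y x
      simpa only [h7] using h6
  simp_rw [hF] at h3
  have h4 : (∫ θ in (0 : ℝ)..2 * Real.pi,
      inner ℂ (f (circleMap 0 r θ)) (f (circleMap 0 r θ)))
      = (2 * Real.pi : ℂ) * (mean f r : ℝ) := by
    simp_rw [inner_self_eq_norm_sq_to_K]
    unfold mean Real.circleAverage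
    have : (∫ θ in (0 : ℝ)..2 * Real.pi, ((‖f (circleMap 0 r θ)‖ : ℂ) ^ 2))
      = ((∫ θ in (0 : ℝ)..2 * Real.pi, ‖f (circleMap 0 r θ)‖ ^ 2 : ℝ) : ℂ) := by
      rw [← intervalIntegral.integral_ofReal]
      simp
    refine this.trans ?_
    have hpi : (Real.pi : ℂ) ≠ 0 := by exact_mod_cast Real.pi_ne_zero
    simp
    field_simp
  rw [h4] at h3
  have h5 := Complex.hasSum_iff _ _ |>.1 h3 |>.1
  have h6 := h5.mul_left ((2 * Real.pi)⁻¹)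
  have hpi : 2 * Real.pi ≠ 0 := by positivity
  have e : ∀ x : ℝ, (2 * Real.pi)⁻¹ * ((2 * Real.pi : ℂ) * (x : ℂ)).re = x := by
    intro x
    have : ((2 * Real.pi : ℂ) * (x : ℂ)).re = 2 * Real.pi * x := by
      rw [← Complex.ofReal_re (2 * Real.pi * x)]
      push_cast
      rfl
    rw [this, inv_mul_cancel_left₀ hpi]
  simpa only [e] using h6

theorem series_unique [CompleteSpace E] {a b : ℕ → E} {f : ℂ → E}
    (ha : ∀ z ∈ Metric.ball (0 : ℂ) 1, HasSum (fun n => z ^ n • a n) (f z))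
    (hb : ∀ z ∈ Metric.ball (0 : ℂ) 1, HasSum (fun n => z ^ n • b n) (f z)) : a = b := by
  have h0 : ∀ z ∈ Metric.ball (0 : ℂ) 1,
      HasSum (fun n => z ^ n • (a - b) n) ((fun _ => 0 : ℂ → E) z) := by
    intro z hz
    simpa [smul_sub] using (ha z hz).sub (hb z hz)
  have h := hasSum_mean (r := 1 / 2) continuousOn_const h0 (by norm_num)
  have hm : mean (fun _ => 0 : ℂ → E) (1 / 2) = 0 := by simp [mean, Real.circleAverage]
  rw [hm, hasSum_zero_iff_of_nonneg (fun n => sq_nonneg _)] at h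
  funext n
  have := congrFun h n
  simpa [sub_eq_zero] using this

/-- Bounded integral means amount to square summable coefficients, and the supremum of the means is
the sum of the squares. -/
theorem mean_le_of_summable [CompleteSpace E] {a : ℕ → E} {f : ℂ → E}
    (hf : ContinuousOn f (Metric.ball (0 : ℂ) 1))
    (h : ∀ z ∈ Metric.ball (0 : ℂ) 1, HasSum (fun n => z ^ n • a n) (f z))
    (hs : Summable (fun n => ‖a n‖ ^ 2)) {r : ℝ} (hr : r ∈ Set.Ico (0 : ℝ) 1) :
    mean f r ≤ ∑' n, ‖a n‖ ^ 2 := by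
  have h1 := hasSum_mean hf h hr
  rw [← h1.tsum_eq]
  refine h1.summable.tsum_le_tsum (fun n => ?_) hs
  rw [mul_pow]
  exact mul_le_of_le_one_left (sq_nonneg _)
    (pow_le_one₀ (pow_nonneg hr.1 n) (pow_le_one₀ hr.1 hr.2.le))

theorem sum_le_of_mean_le [CompleteSpace E] {a : ℕ → E} {f : ℂ → E}
    (hf : ContinuousOn f (Metric.ball (0 : ℂ) 1))
    (h : ∀ z ∈ Metric.ball (0 : ℂ) 1, HasSum (fun n => z ^ n • a n) (f z))
    {M : ℝ} (hM : ∀ r ∈ Set.Ico (0 : ℝ) 1, mean f r ≤ M) (s : Finset ℕ) :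
    ∑ n ∈ s, ‖a n‖ ^ 2 ≤ M := by
  have hc : Continuous (fun r : ℝ => ∑ n ∈ s, (r ^ n * ‖a n‖) ^ 2) := by fun_prop
  have ht : Tendsto (fun r : ℝ => ∑ n ∈ s, (r ^ n * ‖a n‖) ^ 2) (𝓝[<] 1)
      (𝓝 (∑ n ∈ s, ‖a n‖ ^ 2)) := by
    have := (hc.tendsto 1).mono_left (nhdsWithin_le_nhds (s := Set.Iio 1))
    simpa using this
  refine le_of_tendsto ht ?_
  filter_upwards [Ico_mem_nhdsLT (zero_lt_one' ℝ)] with r hr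
  exact (sum_le_hasSum s (fun n _ => sq_nonneg _) (hasSum_mean hf h hr)).trans (hM r hr)

end PowerSeries

variable (E : Type*) [NormedAddCommGroup E] [InnerProductSpace ℂ E]

/-- The functions that are holomorphic on the open unit disc `𝔻` with bounded integral means.
A function on `𝔻` is represented by its extension by `0` to `ℂ`, so that two elements are equal
exactly if they agree on `𝔻`. -/
def hardySubmodule : Submodule ℂ (ℂ → E) where
  carrier := {f | DifferentiableOn ℂ f (Metric.ball 0 1) ∧ (∀ z ∉ Metric.ball (0 : ℂ) 1, f z = 0) ∧
    BddAbove (Set.range fun r : Set.Ico (0 : ℝ) 1 => mean f r)}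
  zero_mem' := ⟨differentiableOn_const 0, fun _ _ => rfl, 0, by
    rintro _ ⟨r, rfl⟩
    simp [mean, Real.circleAverage]⟩
  add_mem' := by
    rintro f g ⟨hf, hf0, M, hM⟩ ⟨hg, hg0, N, hN⟩
    refine ⟨hf.add hg, fun z hz => by simp [hf0 z hz, hg0 z hz], 2 * M + 2 * N, ?_⟩
    rintro _ ⟨r, rfl⟩
    have h1 := hM ⟨r, rfl⟩
    have h2 := hN ⟨r, rfl⟩
    have cf := continuous_comp_circleMap hf.continuousOn r.2
    have cg := continuous_comp_circleMap hg.continuousOn r.2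
    have i1 : CircleIntegrable (fun z => (2 : ℝ) • ‖f z‖ ^ 2) 0 r :=
      Continuous.intervalIntegrable (u := fun θ => (2 : ℝ) • ‖f (circleMap 0 r θ)‖ ^ 2)
        (by have h := cf.norm; fun_prop) _ _
    have i2 : CircleIntegrable (fun z => (2 : ℝ) • ‖g z‖ ^ 2) 0 r :=
      Continuous.intervalIntegrable (u := fun θ => (2 : ℝ) • ‖g (circleMap 0 r θ)‖ ^ 2)
        (by have h := cg.norm; fun_prop) _ _
    have i3 : CircleIntegrable (fun z => ‖(f + g) z‖ ^ 2) 0 r :=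
      ((cf.add cg).norm.pow 2).intervalIntegrable _ _
    have key : mean (f + g) r ≤ 2 * mean f r + 2 * mean g r := by
      have := Real.circleAverage_mono i3 (i1.add i2) (fun z _ => by
        simp only [Pi.add_apply, smul_eq_mul]
        have := norm_add_le (f z) (g z)
        nlinarith [sq_nonneg (‖f z‖ - ‖g z‖), norm_nonneg (f z + g z)])
      rw [Real.circleAverage_add i1 i2, Real.circleAverage_fun_smul,
        Real.circleAverage_fun_smul] at this
      exact this
    have h1' : mean f r ≤ M := h1
    have h2' : mean g r ≤ N := h2
    show mean (f + g) r ≤ _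
    linarith
  smul_mem' := by
    rintro c f ⟨hf, hf0, M, hM⟩
    refine ⟨hf.const_smul c, fun z hz => by simp [hf0 z hz], ‖c‖ ^ 2 * M, ?_⟩
    rintro _ ⟨r, rfl⟩
    have h1 : mean f r ≤ M := hM ⟨r, rfl⟩
    have e : mean (c • f) r = ‖c‖ ^ 2 * mean f r := by
      unfold mean
      rw [← smul_eq_mul, ← Real.circleAverage_fun_smul]
      simp [norm_smul, mul_pow]
    show mean (c • f) r ≤ _
    rw [e]
    exact mul_le_mul_of_nonneg_left h1 (sq_nonneg _)

/-- The Hardy space `H²_E(𝔻)` of `E`-valued functions on the open unit disc. -/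
def H2 : Type _ := hardySubmodule E

namespace H2

instance : AddCommGroup (H2 E) := inferInstanceAs (AddCommGroup (hardySubmodule E))

instance : Module ℂ (H2 E) := inferInstanceAs (Module ℂ (hardySubmodule E))

instance : FunLike (H2 E) ℂ E where
  coe f := Subtype.val (p := (· ∈ hardySubmodule E)) f
  coe_injective _ _ h := Subtype.ext h

variable {E}

/-- A function in the Hardy space, as an element of the Hardy space. -/
def mk (f : ℂ → E) (hf : f ∈ hardySubmodule E) : H2 E := ⟨f, hf⟩

@[simp] theorem mk_apply (f : ℂ → E) (hf : f ∈ hardySubmodule E) (z : ℂ) : mk f hf z = f z := rfl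

@[ext] theorem ext {f g : H2 E} (h : ∀ z, f z = g z) : f = g := DFunLike.ext f g h

@[simp] theorem add_apply (f g : H2 E) (z : ℂ) : (f + g) z = f z + g z := rfl

@[simp] theorem smul_apply (c : ℂ) (f : H2 E) (z : ℂ) : (c • f) z = c • f z := rfl

@[simp] theorem zero_apply (z : ℂ) : (0 : H2 E) z = 0 := rfl

theorem differentiableOn (f : H2 E) : DifferentiableOn ℂ f (Metric.ball 0 1) := f.2.1

theorem eq_zero_of_notMem (f : H2 E) {z : ℂ} (hz : z ∉ Metric.ball (0 : ℂ) 1) : f z = 0 :=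
  f.2.2.1 z hz

theorem bddAbove (f : H2 E) :
    BddAbove (Set.range fun r : Set.Ico (0 : ℝ) 1 => mean f r) := f.2.2.2

/-- The norm `(sup_{0 ≤ r < 1} ∫_𝕋 ‖f(r e^{iθ})‖² dθ)^{1/2}` of the Hardy space. -/
instance : Norm (H2 E) := ⟨fun f => Real.sqrt (⨆ r : Set.Ico (0 : ℝ) 1, mean f r)⟩

theorem norm_def (f : H2 E) : ‖f‖ = Real.sqrt (⨆ r : Set.Ico (0 : ℝ) 1, mean f r) := rfl

/-- The `n`-th Taylor coefficient at the origin. -/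
def coeff (f : H2 E) (n : ℕ) : E := (n.factorial : ℂ)⁻¹ • iteratedDeriv n f 0

theorem mean_le_iSup (f : H2 E) :
    ∀ r ∈ Set.Ico (0 : ℝ) 1, mean f r ≤ ⨆ r : Set.Ico (0 : ℝ) 1, mean f r :=
  fun r hr => le_ciSup f.bddAbove (⟨r, hr⟩ : Set.Ico (0 : ℝ) 1)

variable [CompleteSpace E]

theorem hasSum_coeff (f : H2 E) :
    ∀ z ∈ Metric.ball (0 : ℂ) 1, HasSum (fun n => z ^ n • coeff f n) (f z) := by
  intro z hz
  have h := Complex.hasSum_taylorSeries_on_ball f.differentiableOn hz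
  have e : ∀ n, z ^ n • coeff f n
      = (n.factorial : ℂ)⁻¹ • (z - 0) ^ n • iteratedDeriv n f 0 := by
    intro n
    rw [coeff, sub_zero, smul_comm]
  simpa only [e] using h

theorem summable_coeff (f : H2 E) : Summable (fun n => ‖coeff f n‖ ^ 2) :=
  summable_of_sum_le (fun _ => sq_nonneg _)
    (sum_le_of_mean_le f.differentiableOn.continuousOn f.hasSum_coeff f.mean_le_iSup)

theorem iSup_mean (f : H2 E) :
    ⨆ r : Set.Ico (0 : ℝ) 1, mean f r = ∑' n, ‖coeff f n‖ ^ 2 := by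
  have : Nonempty (Set.Ico (0 : ℝ) 1) := ⟨⟨0, by norm_num⟩⟩
  refine le_antisymm (ciSup_le fun r => ?_) ?_
  · exact mean_le_of_summable f.differentiableOn.continuousOn f.hasSum_coeff f.summable_coeff r.2
  · exact f.summable_coeff.tsum_le_of_sum_le
      (sum_le_of_mean_le f.differentiableOn.continuousOn f.hasSum_coeff f.mean_le_iSup)

theorem coeff_eq {f : H2 E} {a : ℕ → E}
    (h : ∀ z ∈ Metric.ball (0 : ℂ) 1, HasSum (fun n => z ^ n • a n) (f z)) : coeff f = a :=
  series_unique f.hasSum_coeff h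

variable (E) in
/-- The sequence of Taylor coefficients, as a linear map to `ℓ²(ℕ, E)`. -/
def coeffMap : H2 E →ₗ[ℂ] lp (fun _ : ℕ => E) 2 where
  toFun f := ⟨coeff f, memℓp_gen (by simpa using f.summable_coeff)⟩
  map_add' f g := by
    ext1
    refine coeff_eq fun z hz => ?_
    have h := (f.hasSum_coeff z hz).add (g.hasSum_coeff z hz)
    simp only [← smul_add] at h
    exact h
  map_smul' c f := by
    ext1
    refine coeff_eq fun z hz => ?_
    have h := (f.hasSum_coeff z hz).const_smul c
    simp only [smul_comm c] at h
    exact h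

@[simp] theorem coeffMap_apply (f : H2 E) (n : ℕ) : coeffMap E f n = coeff f n := rfl

theorem norm_coeffMap (f : H2 E) : ‖coeffMap E f‖ = ‖f‖ := by
  rw [norm_def, iSup_mean, lp.norm_eq_tsum_rpow (by norm_num), Real.sqrt_eq_rpow]
  simp

theorem coeffMap_injective : Function.Injective (coeffMap E) := by
  intro f g h
  ext z
  by_cases hz : z ∈ Metric.ball (0 : ℂ) 1
  · have e : coeff f = coeff g := congrArg Subtype.val h
    have h1 := f.hasSum_coeff z hz
    rw [e] at h1
    exact h1.unique (g.hasSum_coeff z hz)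
  · rw [f.eq_zero_of_notMem hz, g.eq_zero_of_notMem hz]

theorem coeffMap_surjective : Function.Surjective (coeffMap E) := by
  intro a
  have ha : Summable (fun n => ‖a n‖ ^ 2) := by
    simpa using (lp.memℓp a).summable (by norm_num)
  have hb : ∀ n, ‖a n‖ ≤ ‖a‖ := fun n => lp.norm_apply_le_norm (by norm_num) a n
  have hS : ∀ ρ : ℝ, ρ ∈ Set.Ico (0 : ℝ) 1 → Summable (fun n => ρ ^ n * ‖a‖) := fun ρ hρ =>
    (summable_geometric_of_lt_one hρ.1 hρ.2).mul_right _
  have hle : ∀ (z : ℂ) (ρ : ℝ), ‖z‖ ≤ ρ → ∀ n, ‖z ^ n • a n‖ ≤ ρ ^ n * ‖a‖ := by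
    intro z ρ hz n
    rw [norm_smul, norm_pow]
    exact mul_le_mul (pow_le_pow_left₀ (norm_nonneg z) hz n) (hb n) (norm_nonneg _)
      (pow_nonneg ((norm_nonneg z).trans hz) n)
  let g : ℂ → E := fun z => ∑' n, z ^ n • a n
  have hg : ∀ z ∈ Metric.ball (0 : ℂ) 1, HasSum (fun n => z ^ n • a n) (g z) := by
    intro z hz
    have hz' : ‖z‖ < 1 := by simpa using hz
    exact ((hS ‖z‖ ⟨norm_nonneg z, hz'⟩).of_norm_bounded (hle z _ le_rfl)).hasSum
  have hgd : DifferentiableOn ℂ g (Metric.ball 0 1) := by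
    intro z hz
    have hz' : ‖z‖ < 1 := by simpa using hz
    obtain ⟨ρ, h1, h2⟩ := exists_between hz'
    have hd : DifferentiableOn ℂ g (Metric.ball 0 ρ) :=
      Complex.differentiableOn_tsum_of_summable_norm
        (hS ρ ⟨(norm_nonneg z).trans h1.le, h2⟩)
        (fun n => ((differentiable_id.pow n).smul_const (a n)).differentiableOn) Metric.isOpen_ball
        (fun n w hw => hle w ρ (by simpa using (Metric.mem_ball.1 hw).le) n)
    exact ((hd z (by simpa using h1)).differentiableAt
      (Metric.isOpen_ball.mem_nhds (by simpa using h1))).differentiableWithinAt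
  classical
  let f : ℂ → E := fun z => if z ∈ Metric.ball (0 : ℂ) 1 then g z else 0
  have hfg : Set.EqOn f g (Metric.ball 0 1) := fun z hz => if_pos hz
  have hf : ∀ z ∈ Metric.ball (0 : ℂ) 1, HasSum (fun n => z ^ n • a n) (f z) := by
    intro z hz
    rw [hfg hz]
    exact hg z hz
  have hfd : DifferentiableOn ℂ f (Metric.ball 0 1) := hgd.congr hfg
  refine ⟨H2.mk f ⟨hfd, fun z hz => if_neg hz, ∑' n, ‖a n‖ ^ 2, ?_⟩, ?_⟩
  · rintro _ ⟨r, rfl⟩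
    exact mean_le_of_summable hfd.continuousOn hf ha r.2
  · ext1
    exact coeff_eq hf

instance : NormedAddCommGroup (H2 E) :=
  AddGroupNorm.toNormedAddCommGroup
    { toFun := fun f => ‖f‖
      map_zero' := by rw [← norm_coeffMap, map_zero, norm_zero]
      add_le' := fun f g => by
        simp only [← norm_coeffMap, map_add]
        exact norm_add_le _ _
      neg' := fun f => by simp only [← norm_coeffMap, map_neg, norm_neg]
      eq_zero_of_map_eq_zero' := fun f hf => by
        rw [← norm_coeffMap, norm_eq_zero] at hf
        exact coeffMap_injective (hf.trans (map_zero _).symm) }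

/-- The inner product that induces the norm, `⟨f, g⟩ = ∑ₙ ⟨aₙ, bₙ⟩` in terms of the Taylor
coefficients. -/
instance : InnerProductSpace ℂ (H2 E) where
  norm_smul_le c f := by
    rw [← norm_coeffMap, ← norm_coeffMap f, map_smul]
    exact norm_smul_le _ _
  inner f g := inner ℂ (coeffMap E f) (coeffMap E g)
  norm_sq_eq_re_inner f := by
    rw [← norm_coeffMap]
    exact norm_sq_eq_re_inner (𝕜 := ℂ) _
  conj_inner_symm f g := inner_conj_symm _ _
  add_left f g h := by rw [map_add, inner_add_left]
  smul_left f g c := by rw [map_smul, inner_smul_left]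

variable (E) in
/-- Taylor coefficients identify the Hardy space isometrically with `ℓ²(ℕ, E)`. -/
def coeffEquiv : H2 E ≃ₗᵢ[ℂ] lp (fun _ : ℕ => E) 2 where
  toLinearEquiv := LinearEquiv.ofBijective (coeffMap E) ⟨coeffMap_injective, coeffMap_surjective⟩
  norm_map' := norm_coeffMap

instance : CompleteSpace (H2 E) :=
  (coeffEquiv E).symm.toIsometryEquiv.completeSpace_iff.1 inferInstance

end H2

section Model

variable {E}

theorem mean_mul_le {f : ℂ → E} (hf : ContinuousOn f (Metric.ball (0 : ℂ) 1))
    {r : ℝ} (hr : r ∈ Set.Ico (0 : ℝ) 1) : mean (fun z => z • f z) r ≤ mean f r := by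
  have c1 := continuous_comp_circleMap hf hr
  have c2 := continuous_comp_circleMap (continuousOn_id.smul hf) hr
  refine Real.circleAverage_mono ((c2.norm.pow 2).intervalIntegrable _ _)
    ((c1.norm.pow 2).intervalIntegrable _ _) fun z hz => ?_
  have hz' : ‖z‖ ≤ 1 := by
    have : ‖z‖ = r := by simpa [abs_of_nonneg hr.1] using hz
    rw [this]
    exact hr.2.le
  rw [norm_smul, mul_pow]
  exact mul_le_of_le_one_left (sq_nonneg _) (pow_le_one₀ (norm_nonneg z) hz')

variable [CompleteSpace E]

variable (E) in
/-- The shift `T_z` on `H²_E(𝔻)`, `(T_z f)(w) = w f(w)`. -/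
def shift : H2 E →L[ℂ] H2 E :=
  LinearMap.mkContinuous
    { toFun := fun f => H2.mk (fun w => w • f w) ⟨differentiableOn_id.smul f.differentiableOn,
        fun w hw => by simp only [f.eq_zero_of_notMem hw, smul_zero], by
          obtain ⟨M, hM⟩ := f.bddAbove
          refine ⟨M, ?_⟩
          rintro _ ⟨r, rfl⟩
          exact (mean_mul_le f.differentiableOn.continuousOn r.2).trans (hM ⟨r, rfl⟩)⟩
      map_add' := fun f g => H2.ext fun w => smul_add w (f w) (g w)
      map_smul' := fun c f => H2.ext fun w => smul_comm w c (f w) } 1 (by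
    intro f
    have : Nonempty (Set.Ico (0 : ℝ) 1) := ⟨⟨0, by norm_num⟩⟩
    rw [one_mul]
    refine Real.sqrt_le_sqrt (ciSup_mono f.bddAbove fun r => ?_)
    exact mean_mul_le f.differentiableOn.continuousOn r.2)

@[simp] theorem shift_apply (f : H2 E) (w : ℂ) : shift E f w = w • f w := rfl

/-- `Θ ∈ H^∞_{B(E)}(𝔻)` is an inner multiplier: a bounded holomorphic `B(E)`-valued function on `𝔻`
(the values outside `𝔻` are irrelevant) whose radial limits `Θ(e^{iθ})` (in the strong operator
topology, which is the norm topology for finite-dimensional `E`) exist and are isometries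
for almost every `θ`. -/
structure IsInnerMultiplier (Θ : ℂ → E →L[ℂ] E) : Prop where
  differentiableOn : DifferentiableOn ℂ Θ (Metric.ball 0 1)
  bounded : ∃ C : ℝ, ∀ z ∈ Metric.ball (0 : ℂ) 1, ‖Θ z‖ ≤ C
  isometric_boundary : ∀ᵐ θ : ℝ, ∃ V : E →L[ℂ] E, Isometry V ∧
    ∀ x : E, Tendsto (fun r : ℝ => Θ (r * Complex.exp (θ * Complex.I)) x) (𝓝[<] 1) (𝓝 (V x))

/-- The subspace `Θ H²_E(𝔻) = {Θ f : f ∈ H²_E(𝔻)}` of `H²_E(𝔻)`. -/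
def multiplierRange (Θ : ℂ → E →L[ℂ] E) : Submodule ℂ (H2 E) where
  carrier := {g | ∃ f : H2 E, ∀ z ∈ Metric.ball (0 : ℂ) 1, g z = Θ z (f z)}
  zero_mem' := ⟨0, fun z _ => by simp⟩
  add_mem' := by
    rintro g₁ g₂ ⟨f₁, h₁⟩ ⟨f₂, h₂⟩
    exact ⟨f₁ + f₂, fun z hz => by simp [h₁ z hz, h₂ z hz]⟩
  smul_mem' := by
    rintro c g ⟨f, h⟩
    exact ⟨c • f, fun z hz => by simp [h z hz]⟩

/-- The model space `Q_Θ = H²_E(𝔻) ⊖ Θ H²_E(𝔻)`. -/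
abbrev ModelSpace (Θ : ℂ → E →L[ℂ] E) : Submodule ℂ (H2 E) := (multiplierRange Θ)ᗮ

/-- The model operator `S_Θ = P_{Q_Θ} T_z |_{Q_Θ}`. -/
def modelOperator (Θ : ℂ → E →L[ℂ] E) : ModelSpace Θ →L[ℂ] ModelSpace Θ :=
  (ModelSpace Θ).orthogonalProjectionOnto ∘L shift E ∘L (ModelSpace Θ).subtypeL

end Model

end VectorHardy

end

/-! Write `S` for the model operator. The equivalence holds for any contraction `S` on a Hilbert
space such that `S ^ m` and `S* ^ m` tend strongly to `0` and `1 - S S*` is compact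
(`isCompactOperator_iff_exists_tendsto`). If `T` is compact, strong convergence of `S* ^ m` is
uniform on the relatively compact image of the unit ball, so `S* ^ m T → 0` in norm. Conversely, a
limit `A` of `S* ^ m T S ^ m` satisfies `S* A S = A`, which forces `A = 0`. Then `P T P → 0` in norm
for `P = S ^ m S* ^ m`, while `T - P T P` is compact because `1 - P` is; so `T` is a norm limit of
compact operators.

For the model operator, `S*` is the restriction of the backward shift. This gives `S* ^ m → 0`, and
exhibits `1 - S S*` as a compression of the projection onto the constants, which has finite rank.

The substantial point is `S ^ m → 0`, which reduces to showing that the distance from `z ^ m x` to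
`Θ H²` tends to `0`. Let `Θ_k` be the Taylor coefficients of `Θ`. The image of `z ^ m x` under the
adjoint of multiplication by `Θ` is the polynomial `∑ z ^ j Θ_{m-j}* x`, and its product with `Θ`
misses `z ^ m x` by exactly `‖x‖² - ∑_{k ≤ m} ‖Θ_k* x‖²` in squared norm. Summed over an orthonormal
basis of the finite-dimensional space, `Θ_k*` may be replaced by `Θ_k`, and `∑_k ‖Θ_k x‖² = ‖x‖²`
because `Θ` is isometric on the boundary. -/

/-! ### Strong convergence of contractions -/

/-- Pointwise convergence to zero of a sequence of contractions passes to limits of points. -/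
theorem tendsto_apply_zero_of_tendsto {X Y : Type*} [NormedAddCommGroup X] [NormedSpace ℂ X]
    [NormedAddCommGroup Y] [NormedSpace ℂ Y] {B : ℕ → X →L[ℂ] Y} (hB : ∀ m, ‖B m‖ ≤ 1)
    {u : ℕ → X} {x : X} (hu : Tendsto u atTop (𝓝 x))
    (h : ∀ N, Tendsto (fun m => B m (u N)) atTop (𝓝 0)) :
    Tendsto (fun m => B m x) atTop (𝓝 0) := by
  rw [Metric.tendsto_atTop]
  intro ε hε
  obtain ⟨N, hN⟩ := Metric.tendsto_atTop.1 hu (ε / 2) (half_pos hε)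
  obtain ⟨M, hM⟩ := Metric.tendsto_atTop.1 (h N) (ε / 2) (half_pos hε)
  refine ⟨M, fun m hm => ?_⟩
  have h1 := hN N le_rfl
  have h2 := hM m hm
  rw [dist_eq_norm, norm_sub_rev] at h1
  rw [dist_zero_right] at h2 ⊢
  have h3 : ‖B m (x - u N)‖ ≤ ‖x - u N‖ := (B m).le_of_opNorm_le_of_le (hB m) le_rfl |>.trans
    (one_mul _).le
  have h4 : B m x = B m (x - u N) + B m (u N) := by rw [← map_add, sub_add_cancel]
  rw [h4]
  linarith [norm_add_le (B m (x - u N)) (B m (u N))]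

/-- Contractions that converge to zero strongly do so in norm after composition with a compact
operator. -/
theorem IsCompactOperator.tendsto_norm_comp {X Y Z : Type*} [NormedAddCommGroup X]
    [NormedSpace ℂ X] [NormedAddCommGroup Y] [NormedSpace ℂ Y] [NormedAddCommGroup Z]
    [NormedSpace ℂ Z] {T : X →L[ℂ] Y} (hT : IsCompactOperator T) {B : ℕ → Y →L[ℂ] Z}
    (hB : ∀ m, ‖B m‖ ≤ 1) (h : ∀ y, Tendsto (fun m => B m y) atTop (𝓝 0)) :
    Tendsto (fun m => ‖B m ∘L T‖) atTop (𝓝 0) := by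
  rw [Metric.tendsto_atTop]
  intro ε hε
  have hK : IsCompact (closure (T '' Metric.closedBall 0 1)) :=
    IsCompactOperator.isCompact_closure_image_closedBall (f := T.toLinearMap) hT 1
  -- A finite `ε / 4`-net reduces uniform smallness on the image of the unit ball to finitely many
  -- points; two quarters give the bound `ε / 2`, which is strictly below `ε`.
  obtain ⟨t, -, htf, ht⟩ := hK.finite_cover_balls (e := ε / 4) (by positivity)
  have hev : ∀ᶠ m in atTop, ∀ y ∈ t, ‖B m y‖ < ε / 4 := by
    rw [htf.eventually_all]
    intro y _
    have := (h y).norm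
    rw [norm_zero] at this
    exact this.eventually_lt_const (by positivity)
  obtain ⟨M, hM⟩ := eventually_atTop.1 hev
  refine ⟨M, fun m hm => ?_⟩
  have hle : ‖B m ∘L T‖ ≤ ε / 2 := by
    refine ContinuousLinearMap.opNorm_le_of_unit_norm (by positivity) fun x hx => ?_
    have hmem : T x ∈ closure (T '' Metric.closedBall 0 1) :=
      subset_closure ⟨x, by simp [hx], rfl⟩
    obtain ⟨y, hy, hxy⟩ := Set.mem_iUnion₂.1 (ht hmem)
    rw [Metric.mem_ball, dist_eq_norm] at hxy
    have h3 : ‖B m (T x - y)‖ ≤ ‖T x - y‖ := (B m).le_of_opNorm_le_of_le (hB m) le_rfl |>.trans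
      (one_mul _).le
    have h4 : (B m ∘L T) x = B m (T x - y) + B m y := by simp
    rw [h4]
    linarith [norm_add_le (B m (T x - y)) (B m y), hM m hm y hy]
  rw [dist_zero_right, norm_norm]
  linarith

theorem norm_pow_le_one_of_norm_le_one {X : Type*} [NormedAddCommGroup X] [NormedSpace ℂ X]
    {S : X →L[ℂ] X} (hS : ‖S‖ ≤ 1) (m : ℕ) : ‖S ^ m‖ ≤ 1 := by
  -- The space may be trivial, so at exponent `0` only `‖1‖ ≤ 1` is available.
  rcases Nat.eq_zero_or_pos m with rfl | hm
  · rw [pow_zero]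
    exact ContinuousLinearMap.norm_id_le
  · exact (norm_pow_le' S hm).trans (pow_le_one₀ (norm_nonneg _) hS)

/-! ### The compactness criterion for abstract contractions -/

section Asymptotics

variable {H : Type*} [NormedAddCommGroup H] [InnerProductSpace ℂ H] [CompleteSpace H]

theorem inner_adjoint_pow_left (S : H →L[ℂ] H) (m : ℕ) (x y : H) :
    inner ℂ ((ContinuousLinearMap.adjoint S ^ m) x) y = inner ℂ x ((S ^ m) y) := by
  rw [← ContinuousLinearMap.star_eq_adjoint, ← star_pow, ContinuousLinearMap.star_eq_adjoint,
    ContinuousLinearMap.adjoint_inner_left]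

/-- The defect telescopes, `1 - S ^ (m+1) S* ^ (m+1) = (1 - S S*) + S (1 - S ^ m S* ^ m) S*`, and
compact operators form an ideal. -/
theorem isCompactOperator_one_sub_pow_mul_adjoint_pow {S : H →L[ℂ] H}
    (hc : IsCompactOperator (1 - S * ContinuousLinearMap.adjoint S : H →L[ℂ] H)) (m : ℕ) :
    IsCompactOperator (1 - S ^ m * ContinuousLinearMap.adjoint S ^ m : H →L[ℂ] H) := by
  induction m with
  | zero => simpa using isCompactOperator_zero
  | succ m ih =>
    have e : (1 - S ^ (m + 1) * ContinuousLinearMap.adjoint S ^ (m + 1) : H →L[ℂ] H)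
        = (1 - S * ContinuousLinearMap.adjoint S)
          + S * ((1 - S ^ m * ContinuousLinearMap.adjoint S ^ m)
            * ContinuousLinearMap.adjoint S) := by
      rw [pow_succ' S, pow_succ (ContinuousLinearMap.adjoint S)]
      noncomm_ring
    rw [e]
    exact hc.add ((ih.comp_clm (ContinuousLinearMap.adjoint S)).clm_comp S)

/-- Iterating the fixed-point equation gives `⟨A x, y⟩ = ⟨A S ^ m x, S ^ m y⟩`, whose right side
tends to `0`. -/
theorem eq_zero_of_adjoint_mul_mul_eq {S A : H →L[ℂ] H}
    (hs : ∀ x, Tendsto (fun m : ℕ => (S ^ m) x) atTop (𝓝 0))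
    (hA : ContinuousLinearMap.adjoint S * A * S = A) : A = 0 := by
  have hpow : ∀ m : ℕ, ContinuousLinearMap.adjoint S ^ m * A * S ^ m = A := by
    intro m
    induction m with
    | zero => simp
    | succ m ih =>
      calc ContinuousLinearMap.adjoint S ^ (m + 1) * A * S ^ (m + 1)
          = ContinuousLinearMap.adjoint S ^ m * (ContinuousLinearMap.adjoint S * A * S) * S ^ m := by
            rw [pow_succ, pow_succ']
            noncomm_ring
        _ = A := by rw [hA, ih]
  ext x
  refine ext_inner_right ℂ fun y => ?_
  have h1 : ∀ m : ℕ, inner ℂ (A x) y = inner ℂ (A ((S ^ m) x)) ((S ^ m) y) := by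
    intro m
    rw [← inner_adjoint_pow_left]
    conv_lhs => rw [← hpow m]
    rfl
  have h2 : Tendsto (fun m : ℕ => inner ℂ (A ((S ^ m) x)) ((S ^ m) y)) atTop
      (𝓝 (inner ℂ (A 0) (0 : H))) :=
    ((A.continuous.tendsto 0).comp (hs x)).inner (hs y)
  simp only [← h1] at h2
  simpa using tendsto_nhds_unique tendsto_const_nhds h2

/-- If `S` is a contraction with `S ^ m → 0` and `S* ^ m → 0` strongly and `1 - S S*` is compact,
then `T` is compact if and only if `S* ^ m T S ^ m` converges in norm. -/
theorem isCompactOperator_iff_exists_tendsto {S : H →L[ℂ] H} (hS : ‖S‖ ≤ 1)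
    (hs : ∀ x, Tendsto (fun m : ℕ => (S ^ m) x) atTop (𝓝 0))
    (hs' : ∀ x, Tendsto (fun m : ℕ => (ContinuousLinearMap.adjoint S ^ m) x) atTop (𝓝 0))
    (hc : IsCompactOperator (1 - S * ContinuousLinearMap.adjoint S : H →L[ℂ] H))
    (T : H →L[ℂ] H) :
    IsCompactOperator T ↔ ∃ A : H →L[ℂ] H,
      Tendsto (fun m : ℕ => ‖ContinuousLinearMap.adjoint S ^ m * T * S ^ m - A‖) atTop (𝓝 0) := by
  have hSp := norm_pow_le_one_of_norm_le_one hS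
  have hSp' := norm_pow_le_one_of_norm_le_one (S := ContinuousLinearMap.adjoint S)
    ((LinearIsometryEquiv.norm_map _ S).trans_le hS)
  constructor
  · intro hT
    refine ⟨0, squeeze_zero (fun _ => norm_nonneg _) (fun m => ?_)
      (hT.tendsto_norm_comp hSp' hs')⟩
    rw [sub_zero]
    exact (norm_mul_le _ _).trans (mul_le_of_le_one_right (norm_nonneg _) (hSp m))
  · rintro ⟨A, hA⟩
    have hA' : Tendsto (fun m : ℕ => ContinuousLinearMap.adjoint S ^ m * T * S ^ m) atTop (𝓝 A) :=
      tendsto_iff_norm_sub_tendsto_zero.2 hA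
    -- Conjugating the `m`-th term of the sequence yields the term of index `m + 1`.
    have hfix : ContinuousLinearMap.adjoint S * A * S = A := by
      refine tendsto_nhds_unique ?_ (hA'.comp (tendsto_add_atTop_nat 1))
      have h1 := (hA'.const_mul (ContinuousLinearMap.adjoint S)).mul_const S
      refine h1.congr fun m => ?_
      simp only [Function.comp_apply]
      rw [pow_succ', pow_succ]
      noncomm_ring
    rw [eq_zero_of_adjoint_mul_mul_eq hs hfix] at hA'
    set R : ℕ → H →L[ℂ] H := fun m =>
      S ^ m * (ContinuousLinearMap.adjoint S ^ m * T * S ^ m) * ContinuousLinearMap.adjoint S ^ m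
      with hR
    have hR0 : Tendsto R atTop (𝓝 0) := by
      refine squeeze_zero_norm (fun m => ?_) (by simpa using hA'.norm)
      refine (norm_mul_le _ _).trans ((mul_le_of_le_one_right (norm_nonneg _) (hSp' m)).trans ?_)
      exact (norm_mul_le _ _).trans (mul_le_of_le_one_left (norm_nonneg _) (hSp m))
    refine isCompactOperator_of_tendsto (l := atTop) (F := fun m => T - R m)
      (by simpa using tendsto_const_nhds.sub hR0) (Eventually.of_forall fun m => ?_)
    have hF := isCompactOperator_one_sub_pow_mul_adjoint_pow hc m
    -- With `P = S ^ m S* ^ m` this is `T - P T P = (1 - P) T + P T (1 - P)`.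
    have e : T - R m = (1 - S ^ m * ContinuousLinearMap.adjoint S ^ m) * T
        + (S ^ m * ContinuousLinearMap.adjoint S ^ m * T)
          * (1 - S ^ m * ContinuousLinearMap.adjoint S ^ m) := by
      simp only [hR]
      noncomm_ring
    rw [e]
    exact (hF.comp_clm T).add
      (hF.clm_comp (S ^ m * ContinuousLinearMap.adjoint S ^ m * T))

/-- The Hilbert–Schmidt norms of `A` and its adjoint agree. -/
theorem sum_norm_adjoint_sq {ι : Type*} [Fintype ι] (b : OrthonormalBasis ι ℂ H)
    (A : H →L[ℂ] H) :
    ∑ i, ‖ContinuousLinearMap.adjoint A (b i)‖ ^ 2 = ∑ i, ‖A (b i)‖ ^ 2 := by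
  -- Both sides become the sum of the squared moduli of all matrix entries of `A`.
  simp only [← b.sum_sq_norm_inner_right]
  rw [Finset.sum_comm]
  refine Finset.sum_congr rfl fun i _ => Finset.sum_congr rfl fun j _ => ?_
  rw [ContinuousLinearMap.adjoint_inner_right, norm_inner_symm]

end Asymptotics

/-! ### Monomials and Taylor coefficients in the Hardy space -/

namespace VectorHardy

variable {E : Type*} [NormedAddCommGroup E] [InnerProductSpace ℂ E] [CompleteSpace E]

namespace H2

@[simp] theorem coeff_sub (f g : H2 E) (n : ℕ) : coeff (f - g) n = coeff f n - coeff g n := by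
  simp only [← coeffMap_apply, map_sub]
  rfl

theorem inner_def (f g : H2 E) : inner ℂ f g = inner ℂ (coeffMap E f) (coeffMap E g) := rfl

/-- The monomial `z ^ n • x`. -/
noncomputable def monomial (n : ℕ) : E →L[ℂ] H2 E :=
  (coeffEquiv E).symm.toContinuousLinearEquiv.toContinuousLinearMap ∘L
    lp.singleContinuousLinearMap ℂ (fun _ : ℕ => E) 2 n

theorem coeffMap_monomial (n : ℕ) (x : E) : coeffMap E (monomial n x) = lp.single 2 n x :=
  (coeffEquiv E).apply_symm_apply (lp.single 2 n x)

theorem coeff_monomial (n : ℕ) (x : E) (k : ℕ) :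
    coeff (monomial n x) k = if k = n then x else 0 := by
  rw [← coeffMap_apply, coeffMap_monomial, lp.coeFn_single, Pi.single_apply]

theorem inner_monomial_left (n : ℕ) (x : E) (f : H2 E) :
    inner ℂ (monomial n x) f = inner ℂ x (coeff f n) := by
  rw [inner_def, coeffMap_monomial, lp.inner_single_left, coeffMap_apply]

theorem ext_coeff {f g : H2 E} (h : ∀ n, coeff f n = coeff g n) : f = g :=
  coeffMap_injective (lp.ext (funext h))

theorem monomial_apply (n : ℕ) (x : E) {z : ℂ} (hz : z ∈ Metric.ball (0 : ℂ) 1) :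
    monomial n x z = z ^ n • x := by
  refine ((monomial n x).hasSum_coeff z hz).unique ?_
  have h := hasSum_single (f := fun k => z ^ k • coeff (monomial n x) k) n fun k hk => by
    simp [coeff_monomial, hk]
  simpa [coeff_monomial] using h

theorem norm_monomial (n : ℕ) (x : E) : ‖monomial n x‖ = ‖x‖ := by
  rw [← norm_coeffMap, coeffMap_monomial, lp.norm_single (by norm_num)]

theorem norm_sum_monomial_sq (s : Finset ℕ) (y : ℕ → E) :
    ‖∑ n ∈ s, monomial n (y n)‖ ^ 2 = ∑ n ∈ s, ‖y n‖ ^ 2 := by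
  have h := lp.norm_sum_single (E := fun _ : ℕ => E) (p := 2) (by norm_num) y s
  rw [← norm_coeffMap, map_sum]
  simp only [coeffMap_monomial]
  simpa using h

theorem hasSum_monomial (f : H2 E) : HasSum (fun n => monomial n (coeff f n)) f := by
  have h := lp.hasSum_single (p := 2) (by norm_num) (coeffEquiv E f)
  have h1 := h.mapL (coeffEquiv E).symm.toContinuousLinearEquiv.toContinuousLinearMap
  have e : (coeffEquiv E).symm.toContinuousLinearEquiv.toContinuousLinearMap (coeffEquiv E f) = f :=
    (coeffEquiv E).symm_apply_apply f
  rw [e] at h1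
  exact h1

theorem norm_sq (f : H2 E) : ‖f‖ ^ 2 = ∑' n, ‖coeff f n‖ ^ 2 := by
  rw [norm_def, iSup_mean, Real.sq_sqrt (tsum_nonneg fun _ => sq_nonneg _)]

/-- The integral means converge to the square of the norm as the radius tends to `1`. -/
theorem tendsto_mean (f : H2 E) : Tendsto (mean f) (𝓝[<] 1) (𝓝 (‖f‖ ^ 2)) := by
  have h : Tendsto (fun r : ℝ => ∑' n, (r ^ n * ‖coeff f n‖) ^ 2) (𝓝[<] 1)
      (𝓝 (∑' n, ‖coeff f n‖ ^ 2)) := by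
    -- By Parseval the means are these sums, dominated termwise by the squared coefficients.
    refine tendsto_tsum_of_dominated_convergence f.summable_coeff (fun n => ?_) ?_
    · have hc : Continuous fun r : ℝ => (r ^ n * ‖coeff f n‖) ^ 2 := by fun_prop
      simpa using (hc.tendsto 1).mono_left (nhdsWithin_le_nhds (s := Set.Iio 1))
    · filter_upwards [Ico_mem_nhdsLT (zero_lt_one' ℝ)] with r hr n
      rw [norm_pow, norm_mul, norm_norm, norm_pow, Real.norm_of_nonneg hr.1]
      exact pow_le_pow_left₀ (by have := hr.1; positivity)
        (mul_le_of_le_one_left (norm_nonneg _) (pow_le_one₀ hr.1 hr.2.le)) 2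
  rw [norm_sq]
  refine h.congr' ?_
  filter_upwards [Ico_mem_nhdsLT (zero_lt_one' ℝ)] with r hr
  exact (hasSum_mean f.differentiableOn.continuousOn f.hasSum_coeff hr).tsum_eq

/-- Partial Taylor sums converge to `f` in norm, and the uniform bound on `B m` carries the limit
over. -/
theorem tendsto_apply_zero_of_monomial {Y : Type*} [NormedAddCommGroup Y] [NormedSpace ℂ Y]
    {B : ℕ → H2 E →L[ℂ] Y} (hB : ∀ m, ‖B m‖ ≤ 1)
    (h : ∀ n x, Tendsto (fun m => B m (monomial n x)) atTop (𝓝 0)) (f : H2 E) :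
    Tendsto (fun m => B m f) atTop (𝓝 0) := by
  refine tendsto_apply_zero_of_tendsto hB f.hasSum_monomial.tendsto_sum_nat fun N => ?_
  simp only [map_sum]
  simpa using tendsto_finsetSum (Finset.range N) fun n _ => h n (coeff f n)

end H2

/-! ### The shift and the backward shift -/

open H2

theorem coeff_shift_zero (f : H2 E) : coeff (shift E f) 0 = 0 := by
  simp [coeff]

theorem coeff_shift_succ (f : H2 E) (n : ℕ) : coeff (shift E f) (n + 1) = coeff f n := by
  have h : coeff (shift E f) = fun k => if k = 0 then 0 else coeff f (k - 1) := by
    refine coeff_eq fun z hz => ?_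
    rw [← hasSum_nat_add_iff' 1]
    simpa [pow_succ', mul_smul] using (f.hasSum_coeff z hz).const_smul z
  simp [h]

theorem coeff_shift_pow (m : ℕ) (f : H2 E) (n : ℕ) :
    coeff ((shift E ^ m) f) n = if n < m then 0 else coeff f (n - m) := by
  induction m generalizing n with
  | zero => simp
  | succ m ih =>
    rw [pow_succ', ContinuousLinearMap.mul_def, ContinuousLinearMap.comp_apply]
    cases n with
    | zero => simp [coeff_shift_zero]
    | succ n =>
      rw [coeff_shift_succ, ih]
      simp

theorem shift_pow_monomial (m n : ℕ) (x : E) :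
    (shift E ^ m) (monomial n x) = monomial (n + m) x := by
  refine ext_coeff fun k => ?_
  rw [coeff_shift_pow, coeff_monomial, coeff_monomial]
  split_ifs <;> first | rfl | omega

theorem norm_shift_le : ‖shift E‖ ≤ 1 :=
  LinearMap.mkContinuous_norm_le _ zero_le_one _

/-- By duality: a multiple of `z ^ m` has no coefficient of index `n < m`. -/
theorem shift_adjoint_pow_monomial {m n : ℕ} (h : n < m) (x : E) :
    (ContinuousLinearMap.adjoint (shift E) ^ m) (monomial n x) = 0 := by
  refine ext_inner_right ℂ fun g => ?_
  rw [inner_adjoint_pow_left, inner_monomial_left, coeff_shift_pow, if_pos h]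
  simp

/-- The powers of the backward shift converge to zero strongly. -/
theorem tendsto_shift_adjoint_pow (f : H2 E) :
    Tendsto (fun m : ℕ => (ContinuousLinearMap.adjoint (shift E) ^ m) f) atTop (𝓝 0) := by
  refine tendsto_apply_zero_of_monomial (fun m => norm_pow_le_one_of_norm_le_one
    ((LinearIsometryEquiv.norm_map _ (shift E)).trans_le norm_shift_le) m) (fun n x => ?_) f
  refine tendsto_const_nhds.congr' ?_
  filter_upwards [eventually_gt_atTop n] with m hm
  rw [shift_adjoint_pow_monomial hm]

theorem coeff_shift_adjoint (f : H2 E) (n : ℕ) :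
    coeff (ContinuousLinearMap.adjoint (shift E) f) n = coeff f (n + 1) := by
  refine ext_inner_left ℂ fun x => ?_
  rw [← inner_monomial_left, ContinuousLinearMap.adjoint_inner_right, ← inner_monomial_left]
  have := shift_pow_monomial 1 n x
  rw [pow_one] at this
  rw [this]

/-- `T_z T_z*` erases the constant coefficient and keeps all others, so the defect is the projection
onto the constants; in this factored form it passes through `E`. -/
theorem one_sub_shift_mul_adjoint :
    (1 - shift E * ContinuousLinearMap.adjoint (shift E) : H2 E →L[ℂ] H2 E)
      = monomial 0 ∘L ContinuousLinearMap.adjoint (monomial 0) := by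
  ext1 f
  have e : ContinuousLinearMap.adjoint (monomial 0) f = coeff f 0 := by
    refine ext_inner_left ℂ fun x => ?_
    rw [ContinuousLinearMap.adjoint_inner_right, inner_monomial_left]
  rw [ContinuousLinearMap.comp_apply, e]
  refine ext_coeff fun n => ?_
  change coeff (f - shift E (ContinuousLinearMap.adjoint (shift E) f)) n = _
  rw [coeff_sub, coeff_monomial]
  cases n with
  | zero => simp [coeff_shift_zero]
  | succ n => simp [coeff_shift_succ, coeff_shift_adjoint]

theorem isCompactOperator_one_sub_shift_mul_adjoint [FiniteDimensional ℂ E] :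
    IsCompactOperator
      (1 - shift E * ContinuousLinearMap.adjoint (shift E) : H2 E →L[ℂ] H2 E) := by
  rw [one_sub_shift_mul_adjoint]
  have : ProperSpace E := FiniteDimensional.proper ℂ E
  exact (isCompactOperator_of_locallyCompactSpace_rng (monomial (E := E) 0)).comp_clm _

/-! ### The model operator as a compression of the shift -/

section Model

variable (Θ : ℂ → E →L[ℂ] E)

theorem shift_mem_multiplierRange {g : H2 E} (hg : g ∈ multiplierRange Θ) :
    shift E g ∈ multiplierRange Θ := by
  obtain ⟨f, hf⟩ := hg
  exact ⟨shift E f, fun z hz => by simp [hf z hz]⟩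

theorem shift_adjoint_mem_modelSpace {q : H2 E} (hq : q ∈ ModelSpace Θ) :
    ContinuousLinearMap.adjoint (shift E) q ∈ ModelSpace Θ := by
  rw [Submodule.mem_orthogonal]
  intro u hu
  rw [ContinuousLinearMap.adjoint_inner_right]
  exact (Submodule.mem_orthogonal _ _).1 hq _ (shift_mem_multiplierRange Θ hu)

/-- `Θ H²` is invariant under the shift, so its orthogonal complement is invariant under the
backward shift and no projection is needed on the adjoint side. -/
theorem coe_modelOperator_adjoint (q : ModelSpace Θ) :
    (ContinuousLinearMap.adjoint (modelOperator Θ) q : H2 E)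
      = ContinuousLinearMap.adjoint (shift E) q := by
  have h : ContinuousLinearMap.adjoint (modelOperator Θ) q
      = ⟨ContinuousLinearMap.adjoint (shift E) q, shift_adjoint_mem_modelSpace Θ q.2⟩ := by
    refine ext_inner_right ℂ fun q' => ?_
    rw [ContinuousLinearMap.adjoint_inner_left]
    refine (Submodule.inner_orthogonalProjectionOnto_eq_of_mem_left q _).trans ?_
    exact (ContinuousLinearMap.adjoint_inner_left (shift E) (q' : H2 E) (q : H2 E)).symm
  rw [h]

theorem coe_modelOperator_adjoint_pow (m : ℕ) (q : ModelSpace Θ) :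
    ((ContinuousLinearMap.adjoint (modelOperator Θ) ^ m) q : H2 E)
      = (ContinuousLinearMap.adjoint (shift E) ^ m) q := by
  induction m with
  | zero => rfl
  | succ m ih =>
    rw [pow_succ', pow_succ', ContinuousLinearMap.mul_def, ContinuousLinearMap.mul_def,
      ContinuousLinearMap.comp_apply, ContinuousLinearMap.comp_apply, coe_modelOperator_adjoint, ih]

/-- Dual to the restriction property of the adjoint powers: the intermediate projections can be
dropped. -/
theorem modelOperator_pow_apply (m : ℕ) (q : ModelSpace Θ) :
    (modelOperator Θ ^ m) q
      = (ModelSpace Θ).orthogonalProjectionOnto ((shift E ^ m) (q : H2 E)) := by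
  refine ext_inner_left ℂ fun q' => ?_
  rw [← inner_adjoint_pow_left, Submodule.coe_inner, coe_modelOperator_adjoint_pow,
    inner_adjoint_pow_left, Submodule.inner_orthogonalProjectionOnto_eq_of_mem_left]

theorem norm_modelOperator_le : ‖modelOperator Θ‖ ≤ 1 := by
  refine ContinuousLinearMap.opNorm_le_bound _ zero_le_one fun q => ?_
  have h1 : ‖modelOperator Θ q‖ ≤ ‖shift E (q : H2 E)‖ :=
    Submodule.norm_orthogonalProjectionOnto_apply_le (ModelSpace Θ) (shift E (q : H2 E))
  have h2 : ‖shift E (q : H2 E)‖ ≤ 1 * ‖(q : H2 E)‖ :=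
    (shift E).le_of_opNorm_le norm_shift_le (q : H2 E)
  exact h1.trans h2

theorem tendsto_modelOperator_adjoint_pow (q : ModelSpace Θ) :
    Tendsto (fun m : ℕ => (ContinuousLinearMap.adjoint (modelOperator Θ) ^ m) q) atTop (𝓝 0) := by
  rw [tendsto_subtype_rng]
  simp only [coe_modelOperator_adjoint_pow]
  exact tendsto_shift_adjoint_pow (q : H2 E)

/-- Since `S*` is a restriction of `T_z*`, the defect of `S` is the compression of `1 - T_z T_z*`.
-/
theorem isCompactOperator_one_sub_modelOperator_mul_adjoint [FiniteDimensional ℂ E] :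
    IsCompactOperator (1 - modelOperator Θ * ContinuousLinearMap.adjoint (modelOperator Θ) :
      ModelSpace Θ →L[ℂ] ModelSpace Θ) := by
  have e : (1 - modelOperator Θ * ContinuousLinearMap.adjoint (modelOperator Θ) :
      ModelSpace Θ →L[ℂ] ModelSpace Θ) = (ModelSpace Θ).orthogonalProjectionOnto ∘L
        ((1 - shift E * ContinuousLinearMap.adjoint (shift E)) ∘L (ModelSpace Θ).subtypeL) := by
    ext1 q
    change q - (ModelSpace Θ).orthogonalProjectionOnto (shift E
      (ContinuousLinearMap.adjoint (modelOperator Θ) q : H2 E))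
      = (ModelSpace Θ).orthogonalProjectionOnto ((q : H2 E) - shift E
        (ContinuousLinearMap.adjoint (shift E) (q : H2 E)))
    rw [coe_modelOperator_adjoint, map_sub, Submodule.orthogonalProjectionOnto_mem_subspace_eq_self]
  rw [e]
  exact (isCompactOperator_one_sub_shift_mul_adjoint.comp_clm (ModelSpace Θ).subtypeL).clm_comp
    (ModelSpace Θ).orthogonalProjectionOnto

end Model

end VectorHardy

/-! ### Multiplication by an inner function -/

namespace VectorHardy

open H2

variable {E : Type*} [NormedAddCommGroup E] [InnerProductSpace ℂ E]

namespace IsInnerMultiplier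

variable {Θ : ℂ → E →L[ℂ] E}

/-- Multiplication by `Θ` on the Hardy space. -/
noncomputable def mul (hΘ : IsInnerMultiplier Θ) : H2 E →ₗ[ℂ] H2 E where
  toFun f := H2.mk (fun z => Θ z (f z)) ⟨hΘ.differentiableOn.clm_apply f.differentiableOn,
    fun z hz => by simp only [f.eq_zero_of_notMem hz, map_zero], by
      obtain ⟨C, hC⟩ := hΘ.bounded
      obtain ⟨M, hM⟩ := f.bddAbove
      refine ⟨C ^ 2 * M, ?_⟩
      rintro _ ⟨r, rfl⟩
      have h1 : mean f r ≤ M := hM ⟨r, rfl⟩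
      have c1 := continuous_comp_circleMap f.differentiableOn.continuousOn r.2
      have c2 := continuous_comp_circleMap
        (hΘ.differentiableOn.clm_apply f.differentiableOn).continuousOn r.2
      refine le_trans ?_ (mul_le_mul_of_nonneg_left h1 (sq_nonneg C))
      unfold mean
      rw [← smul_eq_mul, ← Real.circleAverage_fun_smul]
      refine Real.circleAverage_mono ((c2.norm.pow 2).intervalIntegrable _ _)
        (((c1.norm.pow 2).const_smul (C ^ 2)).intervalIntegrable _ _) fun z hz => ?_
      have hz' : z ∈ Metric.ball (0 : ℂ) 1 := by
        have : ‖z‖ = r := by simpa [abs_of_nonneg r.2.1] using hz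
        simp [this, r.2.2]
      rw [smul_eq_mul, ← mul_pow]
      exact pow_le_pow_left₀ (norm_nonneg _) ((Θ z).le_of_opNorm_le (hC z hz') (f z)) 2⟩
  map_add' f g := H2.ext fun z => map_add (Θ z) (f z) (g z)
  map_smul' c f := H2.ext fun z => map_smul (Θ z) c (f z)

@[simp] theorem mul_apply (hΘ : IsInnerMultiplier Θ) (f : H2 E) (z : ℂ) :
    hΘ.mul f z = Θ z (f z) := rfl

theorem mul_mem_multiplierRange (hΘ : IsInnerMultiplier Θ) (f : H2 E) :
    hΘ.mul f ∈ multiplierRange Θ := ⟨f, fun _ _ => rfl⟩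

variable [CompleteSpace E]

theorem mul_shift (hΘ : IsInnerMultiplier Θ) (f : H2 E) :
    hΘ.mul (shift E f) = shift E (hΘ.mul f) := H2.ext fun z => map_smul (Θ z) z (f z)

theorem mul_shift_pow (hΘ : IsInnerMultiplier Θ) (m : ℕ) (f : H2 E) :
    hΘ.mul ((shift E ^ m) f) = (shift E ^ m) (hΘ.mul f) := by
  induction m with
  | zero => rfl
  | succ m ih =>
    rw [pow_succ', ContinuousLinearMap.mul_def, ContinuousLinearMap.comp_apply,
      ContinuousLinearMap.comp_apply, mul_shift, ih]

/-- Multiplication by an inner function preserves the norm of functions that extend continuously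
to the closed disc. -/
theorem norm_mul_of_continuous (hΘ : IsInnerMultiplier Θ) {h : H2 E} {F : ℂ → E}
    (hF : Continuous F) (hh : ∀ z ∈ Metric.ball (0 : ℂ) 1, h z = F z) : ‖hΘ.mul h‖ = ‖h‖ := by
  obtain ⟨C, hC⟩ := hΘ.bounded
  obtain ⟨M, hM⟩ := (isCompact_closedBall (0 : ℂ) 1).exists_bound_of_continuousOn hF.continuousOn
  have hIco := Ico_mem_nhdsLT (zero_lt_one' ℝ)
  have hcirc : ∀ (r θ : ℝ), circleMap 0 r θ = r * Complex.exp (θ * Complex.I) := fun r θ => by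
    simp [circleMap]
  -- The continuous extension `F` supplies the boundary values of `h`, so the two integral means can
  -- be compared by dominated convergence; `C` bounds `Θ` and `M` bounds `F` on the closed disc.
  have hint : Tendsto (fun r : ℝ => ∫ θ in (0 : ℝ)..2 * Real.pi,
      (‖hΘ.mul h (circleMap 0 r θ)‖ ^ 2 - ‖h (circleMap 0 r θ)‖ ^ 2)) (𝓝[<] 1)
      (𝓝 (∫ _ in (0 : ℝ)..2 * Real.pi, (0 : ℝ))) := by
    refine intervalIntegral.tendsto_integral_filter_of_dominated_convergence
      (fun _ => (C * M) ^ 2 + M ^ 2) ?_ ?_ intervalIntegrable_const ?_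
    · filter_upwards [hIco] with r hr
      have c1 := continuous_comp_circleMap h.differentiableOn.continuousOn hr
      have c2 := continuous_comp_circleMap (hΘ.mul h).differentiableOn.continuousOn hr
      exact ((c2.norm.pow 2).sub (c1.norm.pow 2)).aestronglyMeasurable
    · filter_upwards [hIco] with r hr
      refine Eventually.of_forall fun θ _ => ?_
      have hz := circleMap_mem hr θ
      have h1 : ‖h (circleMap 0 r θ)‖ ≤ M := by
        rw [hh _ hz]
        exact hM _ (Metric.ball_subset_closedBall hz)
      have h2 : ‖hΘ.mul h (circleMap 0 r θ)‖ ≤ C * M :=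
        (Θ _).le_of_opNorm_le_of_le (hC _ hz) h1
      refine (norm_sub_le _ _).trans (add_le_add ?_ ?_)
      · rw [norm_pow, norm_norm]
        exact pow_le_pow_left₀ (norm_nonneg _) h2 2
      · rw [norm_pow, norm_norm]
        exact pow_le_pow_left₀ (norm_nonneg _) h1 2
    · filter_upwards [hΘ.isometric_boundary] with θ hθ _
      obtain ⟨V, hV, hlim⟩ := hθ
      set w := F (Complex.exp (θ * Complex.I)) with hw
      have hz : Tendsto (fun r : ℝ => circleMap 0 r θ) (𝓝[<] 1)
          (𝓝 (Complex.exp (θ * Complex.I))) := by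
        have hc : Continuous fun r : ℝ => circleMap 0 r θ := by
          simp only [hcirc]
          fun_prop
        have := (hc.tendsto 1).mono_left (nhdsWithin_le_nhds (s := Set.Iio 1))
        simpa [hcirc] using this
      have hFz : Tendsto (fun r : ℝ => F (circleMap 0 r θ)) (𝓝[<] 1) (𝓝 w) :=
        (hF.tendsto _).comp hz
      -- Radial limits of `Θ` are given on fixed vectors only, so `F` is first replaced by its
      -- boundary value `w`, at a cost controlled by `C`.
      have h0 : Tendsto (fun r : ℝ => Θ (circleMap 0 r θ) (F (circleMap 0 r θ) - w)) (𝓝[<] 1)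
          (𝓝 0) := by
        have hn : Tendsto (fun r : ℝ => C * ‖F (circleMap 0 r θ) - w‖) (𝓝[<] 1) (𝓝 0) := by
          simpa using (hFz.sub_const w).norm.const_mul C
        refine squeeze_zero_norm' ?_ hn
        filter_upwards [hIco] with r hr
        exact (Θ _).le_of_opNorm_le (hC _ (circleMap_mem hr θ)) _
      have h1 : Tendsto (fun r : ℝ => Θ (circleMap 0 r θ) (F (circleMap 0 r θ))) (𝓝[<] 1)
          (𝓝 (V w)) := by
        have := h0.add (hlim w)
        simp only [← hcirc, ← map_add, sub_add_cancel, zero_add] at this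
        exact this
      have hVw : ‖V w‖ = ‖w‖ := hV.norm_map_of_map_zero (map_zero V) w
      have h2 := (h1.norm.pow 2).sub (hFz.norm.pow 2)
      rw [hVw, sub_self] at h2
      refine h2.congr' ?_
      filter_upwards [hIco] with r hr
      rw [mul_apply, hh _ (circleMap_mem hr θ)]
  have hdiff : Tendsto (fun r : ℝ => mean (hΘ.mul h) r - mean h r) (𝓝[<] 1) (𝓝 0) := by
    have h3 := hint.const_mul (2 * Real.pi)⁻¹
    rw [intervalIntegral.integral_zero, mul_zero] at h3
    refine h3.congr' ?_
    filter_upwards [hIco] with r hr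
    have c1 := continuous_comp_circleMap h.differentiableOn.continuousOn hr
    have c2 := continuous_comp_circleMap (hΘ.mul h).differentiableOn.continuousOn hr
    have i1 : IntervalIntegrable (fun θ => ‖h (circleMap 0 r θ)‖ ^ 2) MeasureTheory.volume
      0 (2 * Real.pi) := (c1.norm.pow 2).intervalIntegrable _ _
    have i2 : IntervalIntegrable (fun θ => ‖hΘ.mul h (circleMap 0 r θ)‖ ^ 2) MeasureTheory.volume
      0 (2 * Real.pi) := (c2.norm.pow 2).intervalIntegrable _ _
    rw [intervalIntegral.integral_sub i2 i1, mul_sub]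
    rfl
  have h4 := tendsto_nhds_unique hdiff ((hΘ.mul h).tendsto_mean.sub h.tendsto_mean)
  exact (pow_left_inj₀ (norm_nonneg _) (norm_nonneg _) two_ne_zero).1 (sub_eq_zero.1 h4.symm)

theorem norm_mul_sum_monomial (hΘ : IsInnerMultiplier Θ) (s : Finset ℕ) (y : ℕ → E) :
    ‖hΘ.mul (∑ n ∈ s, monomial n (y n))‖ = ‖∑ n ∈ s, monomial n (y n)‖ := by
  refine hΘ.norm_mul_of_continuous (F := fun z => ∑ n ∈ s, z ^ n • y n) (by fun_prop) fun z hz => ?_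
  classical
  induction s using Finset.induction_on with
  | empty => simp
  | insert a s ha ih =>
    rw [Finset.sum_insert ha, Finset.sum_insert ha, H2.add_apply, ih, monomial_apply _ _ hz]

/-! ### Distance from monomials to the range of the multiplier -/

/-- The `n`-th Taylor coefficient of `Θ` at the origin. -/
noncomputable def taylor (_ : IsInnerMultiplier Θ) (n : ℕ) : E →L[ℂ] E :=
  (n.factorial : ℂ)⁻¹ • iteratedDeriv n Θ 0

theorem coeff_mul_monomial_zero (hΘ : IsInnerMultiplier Θ) (x : E) (n : ℕ) :
    coeff (hΘ.mul (monomial 0 x)) n = hΘ.taylor n x := by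
  have h : coeff (hΘ.mul (monomial 0 x)) = fun n => hΘ.taylor n x := by
    refine coeff_eq fun z hz => ?_
    have h := (Complex.hasSum_taylorSeries_on_ball hΘ.differentiableOn hz).mapL
      (ContinuousLinearMap.apply ℂ E x)
    rw [mul_apply, monomial_apply _ _ hz, pow_zero, one_smul]
    convert h using 2 with n
    · simp [taylor, smul_comm (z ^ n)]
    · rfl
  rw [h]

/-- Multiplication by `Θ` commutes with the shift, so its matrix is lower triangular Toeplitz. -/
theorem coeff_mul_monomial (hΘ : IsInnerMultiplier Θ) {j n : ℕ} (hj : j ≤ n) (x : E) :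
    coeff (hΘ.mul (monomial j x)) n = hΘ.taylor (n - j) x := by
  have h := shift_pow_monomial j 0 x
  rw [zero_add] at h
  rw [← h, mul_shift_pow, coeff_shift_pow, if_neg (not_lt.2 hj), coeff_mul_monomial_zero]

/-- Parseval for the function `Θ x`, whose norm is that of the constant `x`. -/
theorem hasSum_norm_taylor_sq (hΘ : IsInnerMultiplier Θ) (x : E) :
    HasSum (fun n => ‖hΘ.taylor n x‖ ^ 2) (‖x‖ ^ 2) := by
  have h1 : ‖hΘ.mul (monomial 0 x)‖ = ‖x‖ := by
    simpa [norm_monomial] using hΘ.norm_mul_sum_monomial {0} fun _ => x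
  have h2 := (hΘ.mul (monomial 0 x)).summable_coeff.hasSum
  rw [← norm_sq, h1] at h2
  simpa only [coeff_mul_monomial_zero] using h2

/-- The polynomial whose coefficients are those of the projection of the monomial `z ^ m • x` to
`Θ H²`, divided by `Θ`. -/
noncomputable def approx (hΘ : IsInnerMultiplier Θ) (m : ℕ) (x : E) : H2 E :=
  ∑ j ∈ Finset.range (m + 1), monomial j (ContinuousLinearMap.adjoint (hΘ.taylor (m - j)) x)

theorem norm_approx_sq (hΘ : IsInnerMultiplier Θ) (m : ℕ) (x : E) :
    ‖hΘ.approx m x‖ ^ 2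
      = ∑ k ∈ Finset.range (m + 1), ‖ContinuousLinearMap.adjoint (hΘ.taylor k) x‖ ^ 2 := by
  rw [approx, norm_sum_monomial_sq _ fun j => ContinuousLinearMap.adjoint (hΘ.taylor (m - j)) x,
    ← Finset.sum_range_reflect]
  refine Finset.sum_congr rfl fun j hj => ?_
  have := Finset.mem_range.1 hj
  congr 5
  omega

/-- The `m`-th coefficient of `Θ` times the polynomial is `∑_k Θ_k Θ_k* x`, summed over `k ≤ m`;
pairing it with `x` gives `∑_k ‖Θ_k* x‖²`. -/
theorem inner_monomial_mul_approx (hΘ : IsInnerMultiplier Θ) (m : ℕ) (x : E) :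
    inner ℂ (monomial m x) (hΘ.mul (hΘ.approx m x)) = ((‖hΘ.approx m x‖ ^ 2 : ℝ) : ℂ) := by
  rw [norm_approx_sq, approx, map_sum, inner_sum, ← Finset.sum_range_reflect, Complex.ofReal_sum]
  refine Finset.sum_congr rfl fun j hj => ?_
  have hj' := Finset.mem_range.1 hj
  have e : m - (m + 1 - 1 - j) = j := by omega
  rw [inner_monomial_left, coeff_mul_monomial _ (by omega), e,
    ← ContinuousLinearMap.adjoint_inner_left, inner_self_eq_norm_sq_to_K]
  simp

/-- On expanding the square, the cross term contributes `-2 ‖a‖²` for the polynomial `a`, and `‖Θ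
a‖² = ‖a‖²` restores one copy. -/
theorem norm_monomial_sub_mul_approx_sq (hΘ : IsInnerMultiplier Θ) (m : ℕ) (x : E) :
    ‖monomial m x - hΘ.mul (hΘ.approx m x)‖ ^ 2 = ‖x‖ ^ 2
      - ∑ k ∈ Finset.range (m + 1), ‖ContinuousLinearMap.adjoint (hΘ.taylor k) x‖ ^ 2 := by
  have h1 : ‖hΘ.mul (hΘ.approx m x)‖ = ‖hΘ.approx m x‖ :=
    hΘ.norm_mul_sum_monomial _ fun j => ContinuousLinearMap.adjoint (hΘ.taylor (m - j)) x
  rw [norm_sub_sq (𝕜 := ℂ), inner_monomial_mul_approx, h1, norm_monomial, RCLike.re_to_complex,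
    Complex.ofReal_re, norm_approx_sq]
  ring

/-- The errors are controlled only in sum over the basis: `∑_i ‖Θ_k* b_i‖² = ∑_i ‖Θ_k b_i‖²`,
whereas single terms may differ. -/
theorem tendsto_norm_monomial_sub_mul_approx {ι : Type*} [Fintype ι]
    (hΘ : IsInnerMultiplier Θ) (b : OrthonormalBasis ι ℂ E) (i : ι) :
    Tendsto (fun m => ‖monomial m (b i) - hΘ.mul (hΘ.approx m (b i))‖) atTop (𝓝 0) := by
  have hsum : Tendsto (fun m => ∑ i, ‖monomial m (b i) - hΘ.mul (hΘ.approx m (b i))‖ ^ 2) atTop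
      (𝓝 0) := by
    have h1 : Tendsto (fun m => ∑ i, (‖b i‖ ^ 2
        - ∑ k ∈ Finset.range (m + 1), ‖hΘ.taylor k (b i)‖ ^ 2)) atTop (𝓝 0) := by
      have h2 : ∀ i ∈ Finset.univ, Tendsto (fun m => ‖b i‖ ^ 2
          - ∑ k ∈ Finset.range (m + 1), ‖hΘ.taylor k (b i)‖ ^ 2) atTop (𝓝 0) := fun i _ => by
        have := ((hΘ.hasSum_norm_taylor_sq (b i)).tendsto_sum_nat.comp
          (tendsto_add_atTop_nat 1)).const_sub (‖b i‖ ^ 2)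
        rwa [sub_self] at this
      simpa using tendsto_finsetSum Finset.univ h2
    refine h1.congr fun m => ?_
    simp only [norm_monomial_sub_mul_approx_sq, Finset.sum_sub_distrib]
    congr 1
    -- The basis sum is moved inside so that the adjoint can be removed for each Taylor coefficient
    -- separately.
    rw [Finset.sum_comm, Finset.sum_comm (s := Finset.univ)]
    simp only [sum_norm_adjoint_sq]
  have hsq : Tendsto (fun m => ‖monomial m (b i) - hΘ.mul (hΘ.approx m (b i))‖ ^ 2) atTop (𝓝 0) :=
    squeeze_zero (fun _ => sq_nonneg _) (fun m => Finset.single_le_sum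
      (f := fun i => ‖monomial m (b i) - hΘ.mul (hΘ.approx m (b i))‖ ^ 2)
      (fun _ _ => sq_nonneg _) (Finset.mem_univ i)) hsum
  simpa [Real.sqrt_sq] using hsq.sqrt

/-! ### Strong decay of the powers of the model operator -/

theorem tendsto_orthogonalProjectionOnto_monomial [FiniteDimensional ℂ E]
    (hΘ : IsInnerMultiplier Θ) (x : E) :
    Tendsto (fun m => (ModelSpace Θ).orthogonalProjectionOnto (monomial m x)) atTop (𝓝 0) := by
  have hb : ∀ i, Tendsto (fun m => (ModelSpace Θ).orthogonalProjectionOnto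
      (monomial m (stdOrthonormalBasis ℂ E i))) atTop (𝓝 0) := fun i => by
    refine squeeze_zero_norm (fun m => ?_)
      (hΘ.tendsto_norm_monomial_sub_mul_approx (stdOrthonormalBasis ℂ E) i)
    -- The projection kills `Θ H²`, so subtracting an element of it does not change the projected
    -- monomial.
    have h := (ModelSpace Θ).norm_orthogonalProjectionOnto_apply_le
      (monomial m (stdOrthonormalBasis ℂ E i)
        - hΘ.mul (hΘ.approx m (stdOrthonormalBasis ℂ E i)))
    rwa [map_sub, Submodule.orthogonalProjectionOnto_orthogonal_apply_eq_zero
      (hΘ.mul_mem_multiplierRange _), sub_zero] at h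
  have h := tendsto_finsetSum Finset.univ fun i _ =>
    (hb i).const_smul (inner ℂ (stdOrthonormalBasis ℂ E i) x)
  simp only [smul_zero, Finset.sum_const_zero] at h
  refine h.congr fun m => ?_
  conv_rhs => rw [← (stdOrthonormalBasis ℂ E).sum_repr' x]
  simp only [map_sum, map_smul]

theorem tendsto_modelOperator_pow [FiniteDimensional ℂ E] (hΘ : IsInnerMultiplier Θ)
    (q : ModelSpace Θ) : Tendsto (fun m : ℕ => (modelOperator Θ ^ m) q) atTop (𝓝 0) := by
  simp only [modelOperator_pow_apply]
  refine tendsto_apply_zero_of_monomial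
    (B := fun m => (ModelSpace Θ).orthogonalProjectionOnto ∘L shift E ^ m) (fun m => ?_)
    (fun n x => ?_) (q : H2 E)
  · refine (ContinuousLinearMap.opNorm_comp_le _ _).trans (mul_le_one₀ ?_ (norm_nonneg _) ?_)
    · exact Submodule.orthogonalProjectionOnto_norm_le _
    · exact norm_pow_le_one_of_norm_le_one norm_shift_le m
  · simp only [ContinuousLinearMap.comp_apply, shift_pow_monomial]
    simpa only [Function.comp_def, add_comm n] using
      (hΘ.tendsto_orthogonalProjectionOnto_monomial x).comp (tendsto_add_atTop_nat n)

end IsInnerMultiplier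

end VectorHardy

theorem theorem5p5 (p : ℕ)
    (Θ : ℂ → EuclideanSpace ℂ (Fin p) →L[ℂ] EuclideanSpace ℂ (Fin p))
    (hΘ : VectorHardy.IsInnerMultiplier Θ)
    (T : VectorHardy.ModelSpace Θ →L[ℂ] VectorHardy.ModelSpace Θ) :
    IsCompactOperator T ↔
      ∃ A : VectorHardy.ModelSpace Θ →L[ℂ] VectorHardy.ModelSpace Θ,
        Tendsto (fun m : ℕ =>
          ‖(ContinuousLinearMap.adjoint (VectorHardy.modelOperator Θ)) ^ m * T *
            (VectorHardy.modelOperator Θ) ^ m - A‖) atTop (𝓝 0) := by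
  exact isCompactOperator_iff_exists_tendsto (VectorHardy.norm_modelOperator_le Θ)
    hΘ.tendsto_modelOperator_pow (VectorHardy.tendsto_modelOperator_adjoint_pow Θ)
    (VectorHardy.isCompactOperator_one_sub_modelOperator_mul_adjoint Θ) T
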